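/- Let $d,m$ be positive integers, let $f,g_1,\dots,g_m:\mathbb R^d\to\mathbb R^d$ be continuously differentiable, and let $u_1,\dots,u_m:\mathbb R^d\to\mathbb R$ be feedbacks such that each map $x\mapsto f(x)+m\,u_k(x)g_k(x)$ is locally Lipschitz, $f(0)=0$, and $u_k(0)=0$ for all $k$. Put $F(x)=f(x)+\sum_{k=1}^m u_k(x)g_k(x)$. Suppose that $F$ is twice continuously differentiable in a neighborhood of $0$, and that $0$ is a hyperbolic (no eigenvalue of $DF(0)$ on the imaginary axis), locally asymptotically stable equilibrium of the nominal closed loop $\dot x=F(x)$. Let $\mathcal R$ be its basin of attraction, i.e. the set of initial states whose solution exists for all $t\ge 0$ and converges to $0$. Fix $T>0$. A switching-time function is a non-increasing function $\tau:[0,\infty)\to(0,\infty)$ that is constant on each interval $[nT,(n+1)T)$, $n=0,1,2,\dots$, and satisfies $\tau(t)\to0$ as $t\to\infty$. For such $\tau$ let $$\sigma(t;\tau)=1+\left\lfloor \frac{t-m\tau(t)\lfloor t/(m\tau(t))\rfloor}{\tau(t)}\right\rfloor\in\{1,\dots,m\},\qquad t\ge0.$$ Then for every $\bar x\in\mathcal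 R$ there is a switching-time function $\tau'(\cdot;\bar x)$ (depending on $\bar x$) such that for every switching-time function $\tau$ with $\tau(t)\le\tau'(t;\bar x)$ for all $t\ge0$ and every initial time $t_0\ge0$, the round-robin scheduled system $$\dot z(t)=f(z(t))+m\,u_{\sigma(t-t_0;\tau)}(z(t))\,g_{\sigma(t-t_0;\tau)}(z(t)),\qquad z(t_0)=\bar x,\quad t\ge t_0,$$ has a unique Carathéodory solution on $[t_0,\infty)$, and $z(t)\to0$ as $t\to\infty$. -/

import Mathlib

open Filter Topology MeasureTheory Set

noncomputable section

namespace RoundRobin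

/-- The state space `ℝ^d` with the Euclidean norm. -/
abbrev State (d : ℕ) : Type := EuclideanSpace ℝ (Fin d)

/-- `x` is a (global) Carathéodory solution of `x' = F(t, x)`, `x(t₀) = x₀` on `[t₀, ∞)`, written in
the equivalent integral form.  Values of `x` before `t₀` are irrelevant. -/
def IsTrajectory {d : ℕ} (F : ℝ → State d → State d) (t₀ : ℝ) (x₀ : State d)
    (x : ℝ → State d) : Prop :=
  ∀ t, t₀ ≤ t →
    IntervalIntegrable (fun s => F s (x s)) volume t₀ t ∧ x t = x₀ + ∫ s in t₀..t, F s (x s)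

/-- The basin of attraction of `0` for the autonomous system `x' = F(x)`. -/
def basin {d : ℕ} (F : State d → State d) : Set (State d) :=
  {x₀ | (∃ x, IsTrajectory (fun _ => F) 0 x₀ x) ∧
    ∀ x, IsTrajectory (fun _ => F) 0 x₀ x → Tendsto x atTop (𝓝 0)}

/-- `0` is a locally asymptotically stable equilibrium of `x' = F(x)`: Lyapunov stability together
with local attractivity (in particular solutions starting near `0` exist for all times). -/
structure IsLocallyAsymptoticallyStable {d : ℕ} (F : State d → State d) : Prop where
  equilibrium : F 0 = 0
  stable : ∀ ε : ℝ, 0 < ε → ∃ δ : ℝ, 0 < δ ∧ ∀ x₀ : State d, ‖x₀‖ ≤ δ →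
    ∀ x, IsTrajectory (fun _ => F) 0 x₀ x → ∀ t, 0 ≤ t → ‖x t‖ ≤ ε
  attractive : ∃ δ : ℝ, 0 < δ ∧ ∀ x₀ : State d, ‖x₀‖ ≤ δ → x₀ ∈ basin F

/-- `0` is a hyperbolic equilibrium of `x' = F(x)`: no complex eigenvalue of the Jacobian of `F`
at `0` lies on the imaginary axis. -/
structure IsHyperbolicEquilibrium {d : ℕ} (F : State d → State d) : Prop where
  equilibrium : F 0 = 0
  differentiable : DifferentiableAt ℝ F 0
  eigenvalue_re_ne_zero : ∀ μ : ℂ,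
    Module.End.HasEigenvalue ((fderiv ℝ F 0 : State d →ₗ[ℝ] State d).baseChange ℂ) μ → μ.re ≠ 0

/-- The nominal closed-loop vector field `f(x) + ∑ₖ uₖ(x) gₖ(x)`. -/
def closedLoop {d m : ℕ} (f : State d → State d) (g : Fin m → State d → State d)
    (u : Fin m → State d → ℝ) (x : State d) : State d :=
  f x + ∑ k, u k x • g k x

/-- The vector field `f(x) + m uₖ(x) gₖ(x)` in which only the `k`-th input, scaled by `m`, is on. -/
def mode {d m : ℕ} (f : State d → State d) (g : Fin m → State d → State d)
    (u : Fin m → State d → ℝ) (k : Fin m) (x : State d) : State d :=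
  f x + (m : ℝ) • u k x • g k x

/-- The switching index `1 + ⌊(t - m τ(t) ⌊t / (m τ(t))⌋) / τ(t)⌋`, with values in `{1, …, m}`
for `τ(t) > 0`. -/
def switchIndex (m : ℕ) (τ : ℝ → ℝ) (t : ℝ) : ℤ :=
  1 + ⌊(t - m * τ t * (⌊t / (m * τ t)⌋ : ℝ)) / τ t⌋

theorem switchIndex_mem (m : ℕ) [NeZero m] (τ : ℝ → ℝ) (t : ℝ) (hτ : 0 < τ t) :
    1 ≤ switchIndex m τ t ∧ switchIndex m τ t ≤ m := by
  have hm : (0 : ℝ) < m := by exact_mod_cast Nat.pos_of_ne_zero (NeZero.ne m)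
  have hp : 0 < m * τ t := mul_pos hm hτ
  have h1 := Int.floor_le (t / (m * τ t))
  have h2 := Int.lt_floor_add_one (t / (m * τ t))
  rw [le_div_iff₀ hp] at h1
  rw [div_lt_iff₀ hp] at h2
  unfold switchIndex
  constructor
  · have : 0 ≤ ⌊(t - m * τ t * (⌊t / (m * τ t)⌋ : ℝ)) / τ t⌋ :=
      Int.floor_nonneg.2 (div_nonneg (by linarith) hτ.le)
    linarith
  · have : ⌊(t - m * τ t * (⌊t / (m * τ t)⌋ : ℝ)) / τ t⌋ < (m : ℤ) := by
      rw [Int.floor_lt, div_lt_iff₀ hτ]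
      push_cast
      linarith
    omega

/-- The input that is on at time `t`: the switching index counted from `0` instead of `1`. -/
def activeInput (m : ℕ) [NeZero m] (τ : ℝ → ℝ) (t : ℝ) : Fin m :=
  Fin.ofNat m (switchIndex m τ t - 1).toNat

/-- Reduction modulo `m` in `activeInput` never takes effect. -/
theorem activeInput_val (m : ℕ) [NeZero m] (τ : ℝ → ℝ) (t : ℝ) (hτ : 0 < τ t) :
    ((activeInput m τ t : ℕ) : ℤ) + 1 = switchIndex m τ t := by
  obtain ⟨h1, h2⟩ := switchIndex_mem m τ t hτ
  have h : (switchIndex m τ t - 1).toNat < m := by omega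
  simp only [activeInput, Fin.val_ofNat, Nat.mod_eq_of_lt h]
  omega

/-- The round-robin scheduled vector field when the schedule is started at time `t₀`. -/
def scheduled {d m : ℕ} [NeZero m] (f : State d → State d) (g : Fin m → State d → State d)
    (u : Fin m → State d → ℝ) (τ : ℝ → ℝ) (t₀ : ℝ) (t : ℝ) (x : State d) : State d :=
  mode f g u (activeInput m τ (t - t₀)) x

/-- A switching-time function (of the time elapsed since the start): positive, non-increasing,
held constant on each interval `[nT, (n+1)T)`, and tending to `0`. -/
structure IsSwitchingTime (T : ℝ) (τ : ℝ → ℝ) : Prop where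
  pos : ∀ t, 0 ≤ t → 0 < τ t
  antitone : AntitoneOn τ (Ici 0)
  piecewise_const : ∀ n : ℕ, ∀ s ∈ Ico (n * T) ((n + 1) * T), τ s = τ (n * T)
  tendsto_zero : Tendsto τ atTop (𝓝 0)

/-- `τ` dominates `τ'` (it switches at least as fast): `τ ≤ τ'` on `[0, ∞)`. -/
def Dominates (τ τ' : ℝ → ℝ) : Prop :=
  ∀ t, 0 ≤ t → τ t ≤ τ' t

end RoundRobin

end

open RoundRobin

/-! Each input is on for a fraction `1/m` of the time at `m` times its strength, so the scheduled
field averages to the nominal one. While the switching time is constant, the integral of the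
deviation from the mean is of the order of that switching time
(`norm_integral_activeInput_const_le`). Grönwall's inequality turns this into tracking of the
nominal flow on a finite horizon (`exists_tracking`).

Convergence needs infinitely many horizons. Take radii `e j → 0` with stability radii `D j`. Phase
`0` follows the nominal trajectory of the given point into the ball of radius `D 0`. Phase `j + 1`
starts in the ball of radius `D j`, where nominal solutions stay below `e j`, and lasts until all of
them are within `D (j + 1) / 2` (`exists_uniform_attraction`); the other half absorbs the tracking
error. Phase lengths and admissible switching times `c j` are fixed before the schedule, so one
switching-time function can lie below `c j` from phase `j` on (`exists_isSwitchingTime_le`).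

All constants are made global by truncating the fields outside a ball that the solution turns out
never to leave. -/

namespace RoundRobin

/-! ### Grönwall estimates, trajectories and global existence. -/

section

/-- Integral form of Grönwall's inequality. -/
theorem le_mul_exp_of_le_add_integral {h : ℝ → ℝ} {a b η K : ℝ} (hK : 0 ≤ K)
    (hc : ContinuousOn h (Icc a b))
    (hh : ∀ t ∈ Icc a b, h t ≤ η + K * ∫ s in a..t, h s) :
    ∀ t ∈ Icc a b, h t ≤ η * Real.exp (K * (t - a)) := by
  intro t ht
  have hab : a ≤ b := ht.1.trans ht.2
  -- The constant extension of `h` beyond the interval has a primitive that is differentiable at the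
  -- endpoints too.
  have hc' : Continuous (IccExtend hab ((Icc a b).domRestrict h)) :=
    (continuousOn_iff_continuous_domRestrict.1 hc).Icc_extend'
  set k := IccExtend hab ((Icc a b).domRestrict h) with hk
  have hkh : ∀ s ∈ Icc a b, k s = h s := fun s hs => by
    rw [hk, IccExtend_of_mem _ _ hs]; rfl
  have hI : ∀ t ∈ Icc a b, ∫ s in a..t, h s = ∫ s in a..t, k s := fun t ht => by
    apply intervalIntegral.integral_congr
    intro s hs
    rw [uIcc_of_le ht.1] at hs
    exact (hkh s ⟨hs.1, hs.2.trans ht.2⟩).symm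
  have hd : ∀ x, HasDerivAt (fun t => η + K * ∫ s in a..t, k s) (K * k x) x := fun x =>
    ((intervalIntegral.integral_hasDerivAt_right (hc'.intervalIntegrable _ _)
      (hc'.stronglyMeasurableAtFilter _ _) hc'.continuousAt).const_mul K).const_add η
  have key := le_gronwallBound_of_liminf_deriv_right_le (f := fun t => η + K * ∫ s in a..t, k s)
    (f' := fun x => K * k x) (δ := η) (K := K) (ε := 0) (a := a) (b := b)
    (fun x _ => (hd x).continuousAt.continuousWithinAt)
    (fun x _ r hr => (hd x).hasDerivWithinAt.liminf_right_slope_le hr) (by simp)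
    (fun x hx => by
      have hx' := Ico_subset_Icc_self hx
      have := hh x hx'
      rw [hI x hx'] at this
      rw [add_zero, hkh x hx']
      exact mul_le_mul_of_nonneg_left this hK) t ht
  rw [gronwallBound_ε0] at key
  refine (hh t ht).trans ?_
  rw [hI t ht]
  exact key

/-- Grönwall's inequality for an approximate solution of `w' = A`, `‖A‖ ≤ K ‖w‖`, `w a = 0`. -/
theorem norm_le_of_norm_sub_integral_le {E : Type*} [NormedAddCommGroup E] [NormedSpace ℝ E]
    {w A : ℝ → E} {a b η K : ℝ} (hK : 0 ≤ K)
    (hw : ContinuousOn w (Icc a b)) (hA : ∀ s ∈ Icc a b, ‖A s‖ ≤ K * ‖w s‖)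
    (hη : ∀ t ∈ Icc a b, ‖w t - ∫ s in a..t, A s‖ ≤ η) :
    ∀ t ∈ Icc a b, ‖w t‖ ≤ η * Real.exp (K * (t - a)) := by
  refine le_mul_exp_of_le_add_integral hK hw.norm fun t ht => ?_
  have hsub : Icc a t ⊆ Icc a b := Icc_subset_Icc le_rfl ht.2
  have h1 : ‖∫ s in a..t, A s‖ ≤ ∫ s in a..t, K * ‖w s‖ := by
    refine intervalIntegral.norm_integral_le_of_norm_le ht.1 (ae_of_all _ fun s hs =>
      hA s (hsub (Ioc_subset_Icc_self hs))) ?_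
    refine ContinuousOn.intervalIntegrable ?_
    rw [uIcc_of_le ht.1]
    exact (continuousOn_const.mul (hw.mono hsub).norm)
  rw [intervalIntegral.integral_const_mul] at h1
  have h2 := norm_le_norm_sub_add (w t) (∫ s in a..t, A s)
  linarith [hη t ht]

variable {d : ℕ} {G G' : ℝ → State d → State d} {t₀ t₁ : ℝ} {x₀ y₀ : State d} {x y : ℝ → State d}

theorem IsTrajectory.apply_initial (h : IsTrajectory G t₀ x₀ x) : x t₀ = x₀ := by
  simpa using (h t₀ le_rfl).2

theorem IsTrajectory.intervalIntegrable (h : IsTrajectory G t₀ x₀ x) {a b : ℝ} (ha : t₀ ≤ a)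
    (hb : t₀ ≤ b) : IntervalIntegrable (fun s => G s (x s)) volume a b :=
  (h a ha).1.symm.trans (h b hb).1

theorem IsTrajectory.sub_eq (h : IsTrajectory G t₀ x₀ x) {a b : ℝ} (ha : t₀ ≤ a)
    (hb : t₀ ≤ b) : x b - x a = ∫ s in a..b, G s (x s) := by
  rw [(h a ha).2, (h b hb).2, ← intervalIntegral.integral_add_adjacent_intervals (h a ha).1
    (h.intervalIntegrable ha hb)]
  abel

theorem IsTrajectory.restart (h : IsTrajectory G t₀ x₀ x) (h01 : t₀ ≤ t₁) :
    IsTrajectory G t₁ (x t₁) x := fun t ht =>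
  ⟨h.intervalIntegrable h01 (h01.trans ht), by rw [← h.sub_eq h01 (h01.trans ht)]; abel⟩

theorem IsTrajectory.continuousOn (h : IsTrajectory G t₀ x₀ x) : ContinuousOn x (Ici t₀) := by
  intro t ht
  have hlt : t < t + 1 := lt_add_one t
  have ht' : t₀ ≤ t + 1 := (mem_Ici.1 ht).trans hlt.le
  have hc : ContinuousOn x (Icc t₀ (t + 1)) := by
    have := intervalIntegral.continuousOn_primitive_interval' (h (t + 1) ht').1 left_mem_uIcc
    rw [uIcc_of_le ht'] at this
    exact (continuousOn_const.add this).congr fun s hs => (h s hs.1).2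
  refine (hc t ⟨ht, hlt.le⟩).mono_of_mem_nhdsWithin ?_
  rw [← Ici_inter_Iic]
  exact inter_mem_nhdsWithin _ (Iic_mem_nhds hlt)

theorem IsTrajectory.congr (h : IsTrajectory G t₀ x₀ x)
    (hG : ∀ s, t₀ ≤ s → G s (x s) = G' s (x s)) : IsTrajectory G' t₀ x₀ x := by
  intro t ht
  have he : EqOn (fun s => G s (x s)) (fun s => G' s (x s)) (uIcc t₀ t) := fun s hs => by
    rw [uIcc_of_le ht] at hs
    exact hG s hs.1
  refine ⟨(h t ht).1.congr (he.mono uIoc_subset_uIcc), ?_⟩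
  rw [(h t ht).2, intervalIntegral.integral_congr he]

theorem IsTrajectory.shift (h : IsTrajectory G t₀ x₀ x) (c : ℝ) :
    IsTrajectory (fun s => G (s + c)) (t₀ - c) x₀ (fun s => x (s + c)) := by
  intro t ht
  have h1 := h (t + c) (by linarith)
  constructor
  · simpa using h1.1.comp_add_right c
  · change x (t + c) = x₀ + ∫ s in t₀ - c..t, G (s + c) (x (s + c))
    rw [h1.2, intervalIntegral.integral_comp_add_right (fun s => G s (x s)), sub_add_cancel]

/-- Solutions of an equation with a locally Lipschitz right-hand side are unique. -/
theorem IsTrajectory.eqOn (hx : IsTrajectory G t₀ x₀ x) (hy : IsTrajectory G t₀ x₀ y)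
    (hG : ∀ R : ℝ, ∃ K : ℝ, 0 ≤ K ∧ ∀ s p q, ‖p‖ ≤ R → ‖q‖ ≤ R →
      ‖G s p - G s q‖ ≤ K * ‖p - q‖) : EqOn x y (Ici t₀) := by
  intro t ht
  have hcx := hx.continuousOn.mono (Icc_subset_Ici_self : Icc t₀ t ⊆ _)
  have hcy := hy.continuousOn.mono (Icc_subset_Ici_self : Icc t₀ t ⊆ _)
  obtain ⟨R₁, hR₁⟩ := isCompact_Icc.exists_bound_of_continuousOn hcx
  obtain ⟨R₂, hR₂⟩ := isCompact_Icc.exists_bound_of_continuousOn hcy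
  obtain ⟨K, hK, hL⟩ := hG (max R₁ R₂)
  have := norm_le_of_norm_sub_integral_le (w := fun t => x t - y t)
    (A := fun s => G s (x s) - G s (y s)) (η := 0) hK (hcx.sub hcy)
    (fun s hs => hL s _ _ ((hR₁ s hs).trans (le_max_left _ _)) ((hR₂ s hs).trans (le_max_right _ _)))
    (fun s hs => by
      rw [intervalIntegral.integral_sub (hx s hs.1).1 (hy s hs.1).1, (hx s hs.1).2, (hy s hs.1).2]
      simp) t ⟨ht, le_rfl⟩
  rw [zero_mul, norm_le_zero_iff, sub_eq_zero] at this
  exact this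

/-- Continuous dependence on the initial value, with a perturbation of size `η`. -/
theorem IsTrajectory.norm_sub_le {F : State d → State d} {K η a b : ℝ} {z : ℝ → State d}
    (hy : IsTrajectory (fun _ => F) a y₀ y) (hK : 0 ≤ K) (hF : ∀ p q, ‖F p - F q‖ ≤ K * ‖p - q‖)
    (hz : ContinuousOn z (Icc a b))
    (hη : ∀ t ∈ Icc a b, ‖z t - y₀ - ∫ s in a..t, F (z s)‖ ≤ η) :
    ∀ t ∈ Icc a b, ‖z t - y t‖ ≤ η * Real.exp (K * (t - a)) := by
  have hFc : Continuous F := (LipschitzWith.of_dist_le_mul (K := ⟨K, hK⟩) fun p q => by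
    rw [dist_eq_norm, dist_eq_norm]; exact hF p q).continuous
  refine norm_le_of_norm_sub_integral_le (w := fun t => z t - y t)
    (A := fun s => F (z s) - F (y s)) hK
    (hz.sub (hy.continuousOn.mono Icc_subset_Ici_self)) (fun s _ => hF _ _) fun t ht => ?_
  have hi : IntervalIntegrable (fun s => F (z s)) volume a t := by
    refine ContinuousOn.intervalIntegrable ?_
    rw [uIcc_of_le ht.1]
    exact hFc.comp_continuousOn (hz.mono (Icc_subset_Icc le_rfl ht.2))
  change ‖z t - y t - ∫ s in a..t, (F (z s) - F (y s))‖ ≤ η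
  rw [intervalIntegral.integral_sub hi (hy t ht.1).1, (hy t ht.1).2]
  convert hη t ht using 2
  abel

/-- Global existence for a bounded, globally Lipschitz right-hand side that is measurable along
continuous curves. -/
theorem exists_isTrajectory {K M : ℝ} (hK : 0 < K) (hM : 0 ≤ M)
    (hL : ∀ s p q, ‖G s p - G s q‖ ≤ K * ‖p - q‖) (hb : ∀ s p, ‖G s p‖ ≤ M)
    (hm : ∀ w : ℝ → State d, Continuous w → Measurable fun s => G s (w s)) (x₀ : State d) :
    ∃ z : ℝ → State d, IsTrajectory G 0 x₀ z ∧ ∀ s t, ‖z s - z t‖ ≤ M * |s - t| := by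
  have hint : ∀ (w : ℝ → State d), Continuous w → ∀ a b,
      IntervalIntegrable (fun s => G s (w s)) volume a b := fun w hw a b =>
    (intervalIntegrable_const (c := M)).mono_fun (hm w hw).aestronglyMeasurable
      (ae_of_all _ fun s => by simpa [abs_of_nonneg hM] using hb s (w s))
  have hprim : ∀ (w : ℝ → State d), Continuous w →
      Continuous fun t => ∫ s in (0:ℝ)..t, G s (w s) := fun w hw =>
    intervalIntegral.continuous_primitive (hint w hw) 0
  have hbd : ∀ w : ℝ → State d, ∀ a b, ‖∫ s in a..b, G s (w s)‖ ≤ M * |b - a| := fun w a b =>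
    intervalIntegral.norm_integral_le_of_norm_le_const fun s _ => hb s (w s)
  -- Exponentially weighted Picard iteration: the unknown is `exp (-2Ks)` times the solution. The
  -- weight makes the integral operator a `1/2`-contraction on the whole half-line, so no gluing of
  -- local solutions is needed.
  let W : (BoundedContinuousFunction ℝ (State d)) → ℝ → State d :=
    fun y s => Real.exp (2 * K * s) • y s
  have hW : ∀ y, Continuous (W y) := fun y => by
    have := y.continuous
    fun_prop
  let Ψ : BoundedContinuousFunction ℝ (State d) → BoundedContinuousFunction ℝ (State d) := fun y =>
    BoundedContinuousFunction.ofNormedAddCommGroup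
      (fun t => Real.exp (-(2 * K * max t 0)) • (x₀ + ∫ s in (0:ℝ)..max t 0, G s (W y s)))
      (by
        have h1 : Continuous fun t : ℝ => ∫ s in (0:ℝ)..max t 0, G s (W y s) :=
          (hprim _ (hW y)).comp (continuous_id.max continuous_const)
        fun_prop)
      (‖x₀‖ + M / (2 * K)) (fun t => by
        have hu : 0 ≤ max t 0 := le_max_right _ _
        generalize max t 0 = u at hu
        rw [norm_smul, Real.norm_eq_abs, Real.abs_exp, Real.exp_neg,
          inv_mul_le_iff₀ (Real.exp_pos _)]
        have h1 := hbd (W y) 0 u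
        rw [sub_zero, abs_of_nonneg hu] at h1
        have h2 := Real.add_one_le_exp (2 * K * u)
        have h3 : 1 ≤ Real.exp (2 * K * u) := Real.one_le_exp (by positivity)
        have h4 : M * u ≤ Real.exp (2 * K * u) * (M / (2 * K)) := by
          have : M * u = (2 * K * u) * (M / (2 * K)) := by field_simp
          rw [this]
          gcongr
          linarith
        have h5 : ‖x₀‖ ≤ Real.exp (2 * K * u) * ‖x₀‖ :=
          le_mul_of_one_le_left (norm_nonneg _) h3
        calc _ ≤ ‖x₀‖ + ‖∫ s in (0:ℝ)..u, G s (W y s)‖ := norm_add_le _ _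
          _ ≤ _ := by linarith)
  have hcontr : ContractingWith (1 / 2) Ψ := by
    refine ⟨by norm_num, LipschitzWith.of_dist_le_mul fun y y' => ?_⟩
    rw [BoundedContinuousFunction.dist_le (by positivity)]
    intro t
    have hu : 0 ≤ max t 0 := le_max_right _ _
    change dist (Real.exp (-(2 * K * max t 0)) • (x₀ + ∫ s in (0:ℝ)..max t 0, G s (W y s)))
      (Real.exp (-(2 * K * max t 0)) • (x₀ + ∫ s in (0:ℝ)..max t 0, G s (W y' s))) ≤ _
    generalize max t 0 = u at hu
    rw [dist_eq_norm, ← smul_sub, norm_smul, Real.norm_eq_abs, Real.abs_exp, Real.exp_neg,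
      inv_mul_le_iff₀ (Real.exp_pos _), add_sub_add_left_eq_sub,
      ← intervalIntegral.integral_sub (hint _ (hW y) _ _) (hint _ (hW y') _ _)]
    have h1 : ‖∫ s in (0:ℝ)..u, (G s (W y s) - G s (W y' s))‖ ≤
        ∫ s in (0:ℝ)..u, (K * dist y y') * Real.exp (2 * K * s) := by
      refine intervalIntegral.norm_integral_le_of_norm_le hu (ae_of_all _ fun s _ => ?_)
        (Continuous.intervalIntegrable (by fun_prop) _ _)
      refine (hL _ _ _).trans ?_
      rw [← smul_sub, norm_smul, Real.norm_eq_abs, Real.abs_exp, ← dist_eq_norm, mul_assoc K,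
        mul_comm (dist y y')]
      gcongr
      exact BoundedContinuousFunction.dist_coe_le_dist s
    have h2 : ∫ s in (0:ℝ)..u, (K * dist y y') * Real.exp (2 * K * s) =
        (dist y y' / 2) * (Real.exp (2 * K * u) - 1) := by
      rw [intervalIntegral.integral_const_mul, intervalIntegral.integral_comp_mul_left
        (fun s => Real.exp s) (by positivity), integral_exp]
      simp only [mul_zero, Real.exp_zero, smul_eq_mul]
      field_simp
    rw [h2] at h1
    refine h1.trans ?_
    have : 0 ≤ dist y y' := dist_nonneg
    simp only [NNReal.coe_div, NNReal.coe_one, NNReal.coe_ofNat]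
    nlinarith
  set y := hcontr.fixedPoint Ψ with hy
  have hfix : Ψ y = y := hcontr.fixedPoint_isFixedPt
  -- Freezing the curve at `x₀` for negative times makes the Lipschitz bound hold on all of `ℝ`.
  refine ⟨fun t => x₀ + ∫ s in (0:ℝ)..max t 0, G s (W y s), ?_, fun s t => ?_⟩
  · have hz : ∀ t, 0 ≤ t → x₀ + ∫ s in (0:ℝ)..max t 0, G s (W y s) = W y t := by
      intro t ht
      have h1 : y t = Real.exp (-(2 * K * max t 0)) • (x₀ + ∫ s in (0:ℝ)..max t 0, G s (W y s)) :=
        (congrArg (fun f => f t) hfix.symm)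
      change _ = Real.exp (2 * K * t) • y t
      rw [h1, smul_smul, ← Real.exp_add, max_eq_left ht, add_neg_cancel, Real.exp_zero, one_smul]
    intro t ht
    have he : EqOn (fun s => G s (x₀ + ∫ s in (0:ℝ)..max s 0, G s (W y s)))
        (fun s => G s (W y s)) (uIcc 0 t) := fun s hs => by
      rw [uIcc_of_le ht] at hs
      simp only [hz s hs.1]
    refine ⟨(hint _ (hW y) 0 t).congr (he.symm.mono uIoc_subset_uIcc), ?_⟩
    rw [intervalIntegral.integral_congr he]
    simp only [max_eq_left ht]
  · rw [add_sub_add_left_eq_sub,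
      intervalIntegral.integral_interval_sub_left (hint _ (hW y) _ _) (hint _ (hW y) _ _)]
    refine (hbd _ _ _).trans (mul_le_mul_of_nonneg_left ?_ hM)
    exact abs_max_sub_max_le_abs _ _ _

end

/-! ### Averaging over the round-robin schedule. -/

section

variable {d m : ℕ}

theorem measurable_family_comp {H : Fin m → State d → State d} (hH : ∀ k, Continuous (H k))
    {σ : ℝ → Fin m} (hσ : Measurable σ) {w : ℝ → State d} (hw : Continuous w) :
    Measurable fun s => H (σ s) (w s) := by
  have : Measurable fun p : Fin m × State d => H p.1 p.2 :=
    measurable_from_prod_countable_right fun k => (hH k).measurable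
  exact this.comp (hσ.prodMk hw.measurable)

variable [NeZero m]

/-- The term subtracted in `switchIndex` is an integer multiple of `m` once divided by `τ`, and the
result is already in the range of residues. In this form a shift by `τ` visibly advances the input
by one. -/
theorem activeInput_const_val {τ : ℝ} (hτ : 0 < τ) (s : ℝ) :
    ((activeInput m (fun _ => τ) s : ℕ) : ℤ) = ⌊s / τ⌋ % m := by
  have h1 := activeInput_val m (fun _ => τ) s hτ
  have h2 : switchIndex m (fun _ => τ) s = 1 + (⌊s / τ⌋ - m * ⌊s / (m * τ)⌋) := by
    unfold switchIndex
    rw [← Int.floor_sub_intCast]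
    congr 2
    push_cast
    field_simp
  have h3 : ((activeInput m (fun _ => τ) s : ℕ) : ℤ) = ⌊s / τ⌋ - m * ⌊s / (m * τ)⌋ := by omega
  rw [← Int.sub_mul_emod_self_left ⌊s / τ⌋ m ⌊s / (m * τ)⌋, ← h3, Int.emod_eq_of_lt (by positivity)]
  exact_mod_cast (activeInput m (fun _ => τ) s).isLt

/-- Within one period of a schedule with constant switching time every input is on once. -/
theorem activeInput_const_bijective {τ : ℝ} (hτ : 0 < τ) (s : ℝ) :
    Function.Bijective fun j : Fin m => activeInput m (fun _ => τ) (s + j * τ) := by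
  refine Finite.injective_iff_bijective.1 fun i j hij => ?_
  have h := congrArg (fun k : Fin m => ((k : ℕ) : ℤ)) hij
  simp only [activeInput_const_val hτ] at h
  have hfl : ∀ i : Fin m, ⌊(s + i * τ) / τ⌋ = ⌊s / τ⌋ + (i : ℕ) := fun i => by
    rw [add_div, mul_div_cancel_right₀ _ hτ.ne', Int.floor_add_natCast]
  rw [hfl, hfl] at h
  have h' : ((i : ℕ) : ℤ) ≡ ((j : ℕ) : ℤ) [ZMOD m] := Int.ModEq.add_left_cancel' _ h
  have := (Int.natCast_modEq_iff.1 h').eq_of_lt_of_lt i.isLt j.isLt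
  exact Fin.ext this

theorem measurable_activeInput {τ : ℝ → ℝ} (hτ : Measurable τ) : Measurable (activeInput m τ) := by
  have h : Measurable (switchIndex m τ) := by
    unfold switchIndex
    have h1 : Measurable fun t => ((⌊t / (m * τ t)⌋ : ℤ) : ℝ) :=
      (measurable_from_top (f := fun n : ℤ => (n : ℝ))).comp
        (measurable_id.div (hτ.const_mul _)).floor
    have h2 : Measurable fun t => ⌊(t - m * τ t * (⌊t / (m * τ t)⌋ : ℝ)) / τ t⌋ :=
      ((measurable_id.sub ((hτ.const_mul _).mul h1)).div hτ).floor
    exact h2.const_add 1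
  exact (measurable_from_top (f := fun n : ℤ => Fin.ofNat m (n - 1).toNat)).comp h

/-- Averaging: a zero-mean family of vector fields that is switched on cyclically along a Lipschitz
curve has an integral of the order of the switching time. -/
theorem norm_integral_activeInput_const_le {W : Fin m → State d → State d} {L B M τ : ℝ}
    (hL : ∀ k p q, ‖W k p - W k q‖ ≤ L * ‖p - q‖) (hL0 : 0 ≤ L) (hB : ∀ k p, ‖W k p‖ ≤ B)
    (hW : ∀ p, ∑ k, W k p = 0) {z : ℝ → State d} (hM : 0 ≤ M)
    (hz : ∀ s t, ‖z s - z t‖ ≤ M * |s - t|) (hτ : 0 < τ) {a b : ℝ} (hab : a ≤ b) :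
    ‖∫ s in a..b, W (activeInput m (fun _ => τ) s) (z s)‖ ≤
      (L * M * (b - a) + 2 * B) * (m * τ) := by
  have hB0 : 0 ≤ B := (norm_nonneg _).trans (hB 0 0)
  have hm : (0 : ℝ) < m := by exact_mod_cast Nat.pos_of_ne_zero (NeZero.ne m)
  have hWc : ∀ k, Continuous (W k) := fun k =>
    (LipschitzWith.of_dist_le_mul (K := ⟨L, hL0⟩) fun p q => by
      rw [dist_eq_norm, dist_eq_norm]; exact hL k p q).continuous
  have hzc : Continuous z := (LipschitzWith.of_dist_le_mul (K := ⟨M, hM⟩) fun p q => by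
      rw [dist_eq_norm, Real.dist_eq]; exact hz p q).continuous
  set φ : ℝ → State d := fun s => W (activeInput m (fun _ => τ) s) (z s) with hφ
  have hφm : Measurable φ := measurable_family_comp hWc (measurable_activeInput measurable_const) hzc
  have hφi : ∀ a b, IntervalIntegrable φ volume a b := fun a b =>
    (intervalIntegrable_const (c := B)).mono_fun hφm.aestronglyMeasurable
      (ae_of_all _ fun s => by simpa [abs_of_nonneg hB0] using hB _ (z s))
  have hφb : ∀ a b, ‖∫ s in a..b, φ s‖ ≤ B * |b - a| := fun a b =>
    intervalIntegral.norm_integral_le_of_norm_le_const fun s _ => hB _ (z s)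
  have hj : ∀ j : Fin m, ((j : ℕ) : ℝ) * τ ≤ m * τ := fun j => by
    have : ((j : ℕ) : ℝ) ≤ m := by exact_mod_cast j.isLt.le
    gcongr
  -- A shift of the integrand changes the integral only by two end pieces of length at most `m * τ`.
  have hshift : ∀ j : Fin m,
      ‖(∫ s in a..b, φ s) - ∫ s in a..b, φ (s + (j : ℕ) * τ)‖ ≤ 2 * B * (m * τ) := by
    intro j
    have h0 : 0 ≤ ((j : ℕ) : ℝ) * τ := by positivity
    rw [intervalIntegral.integral_comp_add_right,
      intervalIntegral.integral_interval_sub_interval_comm (hφi _ _) (hφi _ _) (hφi _ _)]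
    have h1 := hφb a (a + (j : ℕ) * τ)
    have h2 := hφb b (b + (j : ℕ) * τ)
    rw [add_sub_cancel_left, abs_of_nonneg h0] at h1 h2
    have h3 := mul_le_mul_of_nonneg_left (hj j) hB0
    refine (norm_sub_le _ _).trans ?_
    linarith
  -- With `z` frozen at time `s`, the shifts run through every input once and the sum vanishes;
  -- unfreezing moves `z` by at most `M * (m * τ)`.
  have hsum : ‖∫ s in a..b, ∑ j : Fin m, φ (s + (j : ℕ) * τ)‖ ≤
      (m * (L * (M * (m * τ)))) * (b - a) := by
    rw [← abs_of_nonneg (sub_nonneg.2 hab)]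
    refine intervalIntegral.norm_integral_le_of_norm_le_const fun s _ => ?_
    have h0 : ∑ j : Fin m, W (activeInput m (fun _ => τ) (s + (j : ℕ) * τ)) (z s) = 0 := by
      rw [← hW (z s)]
      exact (activeInput_const_bijective hτ s).sum_comp (fun k => W k (z s))
    rw [← sub_zero (∑ j : Fin m, φ (s + (j : ℕ) * τ)), ← h0, ← Finset.sum_sub_distrib]
    refine (norm_sum_le _ _).trans ?_
    refine (Finset.sum_le_card_nsmul _ _ (L * (M * (m * τ))) fun j _ => ?_).trans_eq (by simp)
    refine (hL _ _ _).trans (mul_le_mul_of_nonneg_left ((hz _ _).trans ?_) hL0)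
    rw [add_sub_cancel_left, abs_of_nonneg (by positivity)]
    exact mul_le_mul_of_nonneg_left (hj j) hM
  have hdecomp : (m : ℝ) • ∫ s in a..b, φ s =
      ∑ j : Fin m, ((∫ s in a..b, φ s) - ∫ s in a..b, φ (s + (j : ℕ) * τ)) +
        ∫ s in a..b, ∑ j : Fin m, φ (s + (j : ℕ) * τ) := by
    rw [intervalIntegral.integral_finsetSum fun j _ => by
        simpa using (hφi (a + (j : ℕ) * τ) (b + (j : ℕ) * τ)).comp_add_right ((j : ℕ) * τ),
      Finset.sum_sub_distrib]
    simp [Nat.cast_smul_eq_nsmul]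
  have h1 : (m : ℝ) * ‖∫ s in a..b, φ s‖ ≤
      m * (2 * B * (m * τ)) + (m * (L * (M * (m * τ)))) * (b - a) := by
    rw [← Real.norm_of_nonneg hm.le, ← norm_smul, hdecomp, Real.norm_of_nonneg hm.le]
    refine (norm_add_le _ _).trans (add_le_add ((norm_sum_le _ _).trans ?_) hsum)
    exact (Finset.sum_le_card_nsmul _ _ _ fun j _ => hshift j).trans_eq (by simp)
  refine le_of_mul_le_mul_left (h1.trans_eq ?_) hm
  ring

/-- The mean of a family of vector fields. -/
noncomputable def meanField (H : Fin m → State d → State d) (x : State d) : State d :=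
  (m : ℝ)⁻¹ • ∑ k, H k x

theorem meanField_norm_sub_le {H : Fin m → State d → State d} {K : ℝ}
    (hL : ∀ k p q, ‖H k p - H k q‖ ≤ K * ‖p - q‖) (p q : State d) :
    ‖meanField H p - meanField H q‖ ≤ K * ‖p - q‖ := by
  have hm : (0 : ℝ) < m := by exact_mod_cast Nat.pos_of_ne_zero (NeZero.ne m)
  rw [meanField, meanField, ← smul_sub, norm_smul, norm_inv, Real.norm_of_nonneg hm.le,
    inv_mul_le_iff₀ hm, ← Finset.sum_sub_distrib]
  refine (norm_sum_le _ _).trans ?_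
  exact (Finset.sum_le_card_nsmul _ _ _ fun j _ => hL j p q).trans_eq (by simp)

theorem meanField_norm_le {H : Fin m → State d → State d} {M : ℝ}
    (hb : ∀ k p, ‖H k p‖ ≤ M) (p : State d) : ‖meanField H p‖ ≤ M := by
  have hm : (0 : ℝ) < m := by exact_mod_cast Nat.pos_of_ne_zero (NeZero.ne m)
  rw [meanField, norm_smul, norm_inv, Real.norm_of_nonneg hm.le, inv_mul_le_iff₀ hm]
  refine (norm_sum_le _ _).trans ?_
  exact (Finset.sum_le_card_nsmul _ _ _ fun j _ => hb j p).trans_eq (by simp)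

variable {H : Fin m → State d → State d} {K M T : ℝ}

/-- Averaging over finitely many intervals of constancy of the switching time. -/
theorem norm_integral_sub_average_le (hK : 0 ≤ K)
    (hL : ∀ k p q, ‖H k p - H k q‖ ≤ K * ‖p - q‖) (hb : ∀ k p, ‖H k p‖ ≤ M) (hT : 0 < T)
    {τ : ℝ → ℝ} (hτ : IsSwitchingTime T τ) {z : ℝ → State d} {x₀ : State d}
    (hz : IsTrajectory (fun s => H (activeInput m τ s)) 0 x₀ z)
    (hzL : ∀ s t, ‖z s - z t‖ ≤ M * |s - t|) {c : ℝ} {n : ℕ} (hc : ∀ t, n * T ≤ t → τ t ≤ c) :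
    ∀ N : ℕ, ∀ t ∈ Icc (n * T) ((n + N) * T),
      ‖∫ s in (n * T)..t, (H (activeInput m τ s) (z s) - meanField H (z s))‖ ≤
        N * ((2 * K * M * T + 2 * (2 * M)) * m * c) := by
  have hM : 0 ≤ M := (norm_nonneg _).trans (hb 0 0)
  have hm : (0 : ℝ) < m := by exact_mod_cast Nat.pos_of_ne_zero (NeZero.ne m)
  have hnT : 0 ≤ n * T := by positivity
  have hc0 : 0 < c := (hτ.pos _ hnT).trans_le (hc _ le_rfl)
  have hzc : Continuous z := (LipschitzWith.of_dist_le_mul (K := ⟨M, hM⟩) fun p q => by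
      rw [dist_eq_norm, Real.dist_eq]; exact hzL p q).continuous
  have hAc : Continuous (meanField H) := (LipschitzWith.of_dist_le_mul (K := ⟨K, hK⟩) fun p q => by
      rw [dist_eq_norm, dist_eq_norm]; exact meanField_norm_sub_le hL p q).continuous
  have hint : ∀ a b, 0 ≤ a → 0 ≤ b → IntervalIntegrable
      (fun s => H (activeInput m τ s) (z s) - meanField H (z s)) volume a b := fun a b ha hb =>
    (hz.intervalIntegrable ha hb).sub ((hAc.comp hzc).intervalIntegrable _ _)
  have hseg : ∀ (i : ℕ) (b : ℝ), n ≤ i → i * T ≤ b → b ≤ (i + 1) * T →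
      ‖∫ s in (i * T)..b, (H (activeInput m τ s) (z s) - meanField H (z s))‖ ≤
        (2 * K * M * T + 2 * (2 * M)) * m * c := by
    intro i b hni hib hb'
    have hiT : 0 ≤ i * T := by positivity
    have hpos := hτ.pos _ hiT
    set W : Fin m → State d → State d := fun k p => H k p - meanField H p with hW
    have heq : ∫ s in (i * T)..b, (H (activeInput m τ s) (z s) - meanField H (z s)) =
        ∫ s in (i * T)..b, W (activeInput m (fun _ => τ (i * T)) s) (z s) := by
      -- The right endpoint has to be excluded, since `τ` may jump there.
      refine intervalIntegral.integral_congr_Ioo_of_le hib fun s hs => ?_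
      have := hτ.piecewise_const i s ⟨hs.1.le, hs.2.trans_le hb'⟩
      have h' : activeInput m τ s = activeInput m (fun _ => τ (i * T)) s := by
        rw [← this]
        rfl
      simp only [hW, h']
    rw [heq]
    have key := norm_integral_activeInput_const_le (W := W) (L := 2 * K) (B := 2 * M) (M := M)
      (fun k p q => ?_) (by positivity) (fun k p => ?_) (fun p => ?_) hM hzL hpos hib
    · refine key.trans ?_
      have h1 : τ (i * T) ≤ c := hc _ (by gcongr)
      have h2 : b - i * T ≤ T := by linarith
      rw [mul_assoc _ (m : ℝ) c]
      gcongr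
    · simp only [hW]
      rw [sub_sub_sub_comm]
      refine (norm_sub_le _ _).trans ?_
      linarith [hL k p q, meanField_norm_sub_le hL p q]
    · refine (norm_sub_le _ _).trans ?_
      linarith [hb k p, meanField_norm_le hb p]
    · simp only [hW]
      rw [Finset.sum_sub_distrib]
      simp only [meanField, Finset.sum_const, Finset.card_univ, Fintype.card_fin]
      rw [← Nat.cast_smul_eq_nsmul ℝ, smul_smul, mul_inv_cancel₀ hm.ne', one_smul, sub_self]
  intro N
  induction N with
  | zero =>
    intro t ht
    obtain rfl : t = n * T := le_antisymm (by simpa using ht.2) ht.1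
    simp
  | succ N ih =>
    intro t ht
    push_cast at ht ⊢
    have hC : 0 ≤ (2 * K * M * T + 2 * (2 * M)) * m * c := by positivity
    rcases le_total t ((n + N) * T) with h | h
    · exact (ih t ⟨ht.1, h⟩).trans (by linarith)
    · have h0 : (n : ℝ) * T ≤ (n + N) * T := by
        have : 0 ≤ (N : ℝ) * T := by positivity
        linarith
      rw [← intervalIntegral.integral_add_adjacent_intervals (hint _ ((n + N) * T) hnT
        (hnT.trans h0)) (hint _ _ (hnT.trans h0) (hnT.trans ht.1))]
      have h1 := ih ((n + N) * T) ⟨h0, le_rfl⟩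
      have h2 := hseg (n + N) t (by omega) (by push_cast; exact h)
        (by push_cast; linarith [ht.2])
      push_cast at h2
      refine (norm_add_le _ _).trans ?_
      linarith

/-- On a finite horizon, a solution of the scheduled system follows the averaged system as closely
as desired, provided that the switching is fast enough. -/
theorem exists_tracking (hK : 0 ≤ K)
    (hL : ∀ k p q, ‖H k p - H k q‖ ≤ K * ‖p - q‖) (hb : ∀ k p, ‖H k p‖ ≤ M) (hT : 0 < T)
    (N : ℕ) {ε : ℝ} (hε : 0 < ε) : ∃ c : ℝ, 0 < c ∧
      ∀ τ : ℝ → ℝ, IsSwitchingTime T τ → ∀ (x₀ : State d) (z : ℝ → State d),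
        IsTrajectory (fun s => H (activeInput m τ s)) 0 x₀ z →
        (∀ s t, ‖z s - z t‖ ≤ M * |s - t|) → ∀ n : ℕ, (∀ t, n * T ≤ t → τ t ≤ c) →
        ∀ y, IsTrajectory (fun _ => meanField H) (n * T) (z (n * T)) y →
          ∀ t ∈ Icc (n * T) ((n + N) * T), ‖z t - y t‖ ≤ ε := by
  have hM : 0 ≤ M := (norm_nonneg _).trans (hb 0 0)
  set C := N * ((2 * K * M * T + 2 * (2 * M)) * m) * Real.exp (K * (N * T)) with hC
  have hC0 : 0 ≤ C := by positivity
  -- `C * c` bounds the error: `N` intervals of averaging error, times the Grönwall factor. The `+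
  -- 1` covers `C = 0`.
  refine ⟨ε / (C + 1), by positivity, fun τ hτ x₀ z hz hzL n hc y hy t ht => ?_⟩
  have hnT : 0 ≤ n * T := by positivity
  have hzc : Continuous z := (LipschitzWith.of_dist_le_mul (K := ⟨M, hM⟩) fun p q => by
      rw [dist_eq_norm, Real.dist_eq]; exact hzL p q).continuous
  have hAc : Continuous (meanField H) := (LipschitzWith.of_dist_le_mul (K := ⟨K, hK⟩) fun p q => by
      rw [dist_eq_norm, dist_eq_norm]; exact meanField_norm_sub_le hL p q).continuous
  refine (hy.norm_sub_le hK (meanField_norm_sub_le hL) hzc.continuousOn (fun t ht => ?_) t ht).trans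
    (b := N * ((2 * K * M * T + 2 * (2 * M)) * m * (ε / (C + 1))) * Real.exp (K * (t - n * T))) ?_
  · refine le_trans (le_of_eq ?_) (norm_integral_sub_average_le hK hL hb hT hτ hz hzL hc N t ht)
    have hi : IntervalIntegrable (fun s => meanField H (z s)) volume (n * T) t :=
      (hAc.comp hzc).intervalIntegrable _ _
    rw [intervalIntegral.integral_sub (hz.intervalIntegrable hnT (hnT.trans ht.1)) hi, ← hz.sub_eq hnT (hnT.trans ht.1)]
  · have h1 : t - n * T ≤ N * T := by linarith [ht.2]
    calc _ ≤ N * ((2 * K * M * T + 2 * (2 * M)) * m * (ε / (C + 1))) * Real.exp (K * (N * T)) := by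
          gcongr
      _ = C * (ε / (C + 1)) := by rw [hC]; ring
      _ ≤ ε := by
        rw [mul_div_assoc', div_le_iff₀ (by positivity)]
        linarith

end

/-! ### Truncation, and stability and attraction for the averaged field. -/

section

/-- Coordinatewise truncation to the cube `[-r, r]^d`. -/
noncomputable def clamp {d : ℕ} (r : ℝ) (x : State d) : State d :=
  WithLp.toLp 2 fun i => max (-r) (min (x i) r)

theorem norm_clamp_sub_clamp_le {d : ℕ} (r : ℝ) (x y : State d) :
    ‖clamp r x - clamp r y‖ ≤ ‖x - y‖ := by
  rw [EuclideanSpace.norm_eq, EuclideanSpace.norm_eq]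
  gcongr with i _
  simp only [clamp, PiLp.sub_apply, Real.norm_eq_abs]
  rw [max_comm, max_comm (-r)]
  exact (abs_max_sub_max_le_abs _ _ _).trans 
    ((abs_min_sub_min_le_max _ _ _ _).trans (by simp))

theorem norm_clamp_le {d : ℕ} {r : ℝ} (hr : 0 ≤ r) (x : State d) : ‖clamp r x‖ ≤ √d * r := by
  rw [EuclideanSpace.norm_eq]
  refine Real.sqrt_le_iff.2 ⟨by positivity, ?_⟩
  rw [mul_pow, Real.sq_sqrt (Nat.cast_nonneg _)]
  refine (Finset.sum_le_card_nsmul _ _ (r ^ 2) fun i _ => ?_).trans_eq (by simp)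
  have : |max (-r) (min (x i) r)| ≤ r :=
    abs_le.2 ⟨le_max_left _ _, max_le (by linarith) (min_le_right _ _)⟩
  simp only [clamp, Real.norm_eq_abs]
  gcongr

theorem clamp_eq_self {d : ℕ} {r : ℝ} {x : State d} (hx : ‖x‖ ≤ r) : clamp r x = x := by
  ext i
  have h := abs_le.1 ((PiLp.norm_apply_le x i).trans hx)
  simp only [clamp]
  rw [min_eq_left h.2, max_eq_right h.1]

theorem exists_lipschitz_bound_on_ball {d m : ℕ} {V : Fin m → State d → State d}
    (hV : ∀ k, LocallyLipschitz (V k)) (R : ℝ) : ∃ K M : ℝ, 0 < K ∧ 0 ≤ M ∧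
      ∀ k p q, ‖p‖ ≤ R → ‖q‖ ≤ R → ‖V k p - V k q‖ ≤ K * ‖p - q‖ ∧ ‖V k p‖ ≤ M := by
  have hK : ∀ k, ∃ K, LipschitzOnWith K (V k) (Metric.closedBall 0 R) := fun k =>
    (hV k).locallyLipschitzOn.exists_lipschitzOnWith_of_compact (isCompact_closedBall 0 R)
  have hM : ∀ k, ∃ M, ∀ p ∈ Metric.closedBall (0 : State d) R, ‖V k p‖ ≤ M := fun k =>
    (isCompact_closedBall 0 R).exists_bound_of_continuousOn (hV k).continuous.continuousOn
  choose K hK using hK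
  choose M hM using hM
  -- The `+ 1` makes the constant strictly positive, as the weight in `exists_isTrajectory`
  -- requires.
  refine ⟨∑ k, (K k : ℝ) + 1, ∑ k, |M k|, by positivity, by positivity, fun k p q hp hq => ?_⟩
  rw [← mem_closedBall_zero_iff] at hp hq
  constructor
  · have h1 := (hK k).dist_le_mul p hp q hq
    rw [dist_eq_norm, dist_eq_norm] at h1
    refine h1.trans (mul_le_mul_of_nonneg_right ?_ (norm_nonneg _))
    have := Finset.single_le_sum (f := fun k => (K k : ℝ)) (fun i _ => (K i).2) (Finset.mem_univ k)
    linarith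
  · exact ((hM k p hp).trans (le_abs_self _)).trans
      (Finset.single_le_sum (f := fun k => |M k|) (fun i _ => abs_nonneg _) (Finset.mem_univ k))

theorem meanField_mode {d m : ℕ} [NeZero m] (f : State d → State d) (g : Fin m → State d → State d)
    (u : Fin m → State d → ℝ) (x : State d) : meanField (mode f g u) x = closedLoop f g u x := by
  have hm : (m : ℝ) ≠ 0 := by exact_mod_cast NeZero.ne m
  simp only [meanField, mode, closedLoop, Finset.sum_add_distrib, ← Finset.smul_sum, smul_add,
    Finset.sum_const, Finset.card_univ, Fintype.card_fin]
  rw [← Nat.cast_smul_eq_nsmul ℝ, smul_smul, smul_smul, inv_mul_cancel₀ hm, one_smul, one_smul]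

variable {d : ℕ} {F A : State d → State d} {K M r T : ℝ}

theorem IsTrajectory.eqOn_of_lipschitz (hK : 0 ≤ K) (hA : ∀ p q, ‖A p - A q‖ ≤ K * ‖p - q‖)
    {a : ℝ} {x₀ : State d} {x y : ℝ → State d} (hx : IsTrajectory (fun _ => A) a x₀ x)
    (hy : IsTrajectory (fun _ => A) a x₀ y) : EqOn x y (Ici a) :=
  hx.eqOn hy fun _ => ⟨K, hK, fun _ p q _ _ => hA p q⟩

theorem exists_isTrajectory_autonomous (hK : 0 < K) (hA : ∀ p q, ‖A p - A q‖ ≤ K * ‖p - q‖)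
    (hb : ∀ p, ‖A p‖ ≤ M) (a : ℝ) (x₀ : State d) : ∃ y, IsTrajectory (fun _ => A) a x₀ y := by
  have hAc : Continuous A := (LipschitzWith.of_dist_le_mul (K := ⟨K, hK.le⟩) fun p q => by
      rw [dist_eq_norm, dist_eq_norm]; exact hA p q).continuous
  obtain ⟨z, hz, -⟩ := exists_isTrajectory hK ((norm_nonneg _).trans (hb 0)) (fun _ => hA)
    (fun _ => hb) (fun w hw => (hAc.comp hw).measurable) x₀
  have := hz.shift (-a)
  rw [zero_sub, neg_neg] at this
  exact ⟨_, this⟩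

/-- A globally Lipschitz vector field that agrees with `F` near `0` inherits the local asymptotic
stability of `F`. -/
theorem exists_stable_of_eqOn_ball (hF : IsLocallyAsymptoticallyStable F) (hK : 0 ≤ K)
    (hA : ∀ p q, ‖A p - A q‖ ≤ K * ‖p - q‖) (hr : 0 < r) (hFA : ∀ p, ‖p‖ ≤ r → F p = A p)
    {ε : ℝ} (hε : 0 < ε) : ∃ δ : ℝ, 0 < δ ∧ ∀ (a : ℝ) (x₀ : State d), ‖x₀‖ ≤ δ →
      ∀ y, IsTrajectory (fun _ => A) a x₀ y →
        (∀ t, a ≤ t → ‖y t‖ ≤ ε) ∧ Tendsto y atTop (𝓝 0) := by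
  -- The bound `r` keeps the trajectory of `F` where `F = A`, so it also solves the equation of `A`;
  -- uniqueness for `A` identifies it with `y`.
  obtain ⟨δ₁, hδ₁, hs⟩ := hF.stable (min ε r) (lt_min hε hr)
  obtain ⟨δ₂, hδ₂, ha⟩ := hF.attractive
  refine ⟨min δ₁ δ₂, lt_min hδ₁ hδ₂, fun a x₀ hx₀ y hy => ?_⟩
  obtain ⟨⟨x, hx⟩, hlim⟩ := ha x₀ (hx₀.trans (min_le_right _ _))
  have hxb := hs x₀ (hx₀.trans (min_le_left _ _)) x hx
  have hxA : IsTrajectory (fun _ => A) 0 x₀ x :=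
    hx.congr fun s hs => hFA _ ((hxb s hs).trans (min_le_right _ _))
  have hxa := hxA.shift (-a)
  rw [zero_sub, neg_neg] at hxa
  have heq := hy.eqOn_of_lipschitz hK hA hxa
  constructor
  · intro t ht
    rw [heq ht]
    exact (hxb _ (by linarith)).trans (min_le_left _ _)
  · have h1 : Tendsto (fun s => x (s + -a)) atTop (𝓝 0) :=
      (hlim x hx).comp (tendsto_atTop_add_const_right _ _ tendsto_id)
    exact h1.congr' ((eventually_ge_atTop a).mono fun t ht => (heq ht).symm)

/-- The attraction to `0` is uniform on a compact set of initial values. -/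
theorem exists_uniform_attraction (hF : IsLocallyAsymptoticallyStable F) (hK : 0 < K)
    (hA : ∀ p q, ‖A p - A q‖ ≤ K * ‖p - q‖) (hb : ∀ p, ‖A p‖ ≤ M) (hr : 0 < r)
    (hFA : ∀ p, ‖p‖ ≤ r → F p = A p) (hT : 0 < T) {S : Set (State d)} (hS : IsCompact S)
    (hatt : ∀ x₀ ∈ S, ∀ y, IsTrajectory (fun _ => A) 0 x₀ y → Tendsto y atTop (𝓝 0))
    {ε : ℝ} (hε : 0 < ε) : ∃ N : ℕ, 1 ≤ N ∧ ∀ (a : ℝ), ∀ x₀ ∈ S,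
      ∀ y, IsTrajectory (fun _ => A) a x₀ y → ‖y (a + N * T)‖ ≤ ε := by
  obtain ⟨δ, hδ, hst⟩ := exists_stable_of_eqOn_ball hF hK.le hA hr hFA hε
  have key : ∃ N : ℕ, ∀ x₀ ∈ S, ∀ y, IsTrajectory (fun _ => A) 0 x₀ y →
      ∀ t, N * T ≤ t → ‖y t‖ ≤ ε := by
    -- By compactness a uniform time is needed only near each point: neighbours of `x₀` follow its
    -- trajectory into the ball of radius `δ`, and stability then holds them within `ε`.
    refine hS.induction_on (p := fun S => ∃ N : ℕ, ∀ x₀ ∈ S, ∀ y,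
      IsTrajectory (fun _ => A) 0 x₀ y → ∀ t, N * T ≤ t → ‖y t‖ ≤ ε) ?_ ?_ ?_ ?_
    · exact ⟨0, by simp⟩
    · rintro s s' hss ⟨N, hN⟩
      exact ⟨N, fun x₀ hx₀ => hN x₀ (hss hx₀)⟩
    · rintro s s' ⟨N, hN⟩ ⟨N', hN'⟩
      refine ⟨max N N', fun x₀ hx₀ y hy t ht => ?_⟩
      rcases hx₀ with h | h
      · refine hN x₀ h y hy t (le_trans ?_ ht)
        gcongr
        exact le_max_left _ _
      · refine hN' x₀ h y hy t (le_trans ?_ ht)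
        gcongr
        exact le_max_right _ _
    · intro x₀ hx₀
      obtain ⟨y, hy⟩ := exists_isTrajectory_autonomous hK hA hb 0 x₀
      have hy0 := hatt x₀ hx₀ y hy
      have hn : Tendsto (fun n : ℕ => (n : ℝ) * T) atTop atTop :=
        tendsto_natCast_atTop_atTop.atTop_mul_const hT
      obtain ⟨n, hn⟩ := ((hy0.comp hn).norm.eventually
        (Iio_mem_nhds (show ‖(0 : State d)‖ < δ / 2 by simpa using half_pos hδ))).exists
      set E := Real.exp (K * (n * T)) with hE
      have hEpos : 0 < E := Real.exp_pos _
      refine ⟨_, mem_nhdsWithin_of_mem_nhds (Metric.ball_mem_nhds x₀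
        (show 0 < δ / 2 / E by positivity)), n, fun x₁ hx₁ y₁ hy₁ t ht => ?_⟩
      have hnT : 0 ≤ n * T := by positivity
      have h1 : ‖y₁ (n * T) - y (n * T)‖ ≤ ‖x₁ - x₀‖ * E := by
        have := hy.norm_sub_le hK.le hA (b := n * T) (η := ‖x₁ - x₀‖)
          (hy₁.continuousOn.mono Icc_subset_Ici_self) (fun t ht => by
            rw [(hy₁ t ht.1).2]
            apply le_of_eq
            congr 1
            abel) (n * T) ⟨hnT, le_rfl⟩
        rwa [sub_zero] at this
      have h2 : ‖x₁ - x₀‖ * E < δ / 2 := by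
        rw [mem_ball_iff_norm, lt_div_iff₀ hEpos] at hx₁
        exact hx₁
      have h3 : ‖y₁ (n * T)‖ ≤ δ := by
        have := norm_le_norm_sub_add (y₁ (n * T)) (y (n * T))
        have h4 : ‖y (n * T)‖ < δ / 2 := hn
        linarith
      exact (hst (n * T) _ h3 y₁ (hy₁.restart hnT)).1 t ht
  obtain ⟨N, hN⟩ := key
  -- The extra interval guarantees a positive duration, so that consecutive phases exhaust all
  -- times.
  refine ⟨N + 1, by omega, fun a x₀ hx₀ y hy => ?_⟩
  have hs := hy.shift a
  rw [sub_self] at hs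
  rw [add_comm]
  refine hN x₀ hx₀ _ hs _ ?_
  push_cast
  linarith

end

/-! ### Choice of the switching time and concatenation of phases. -/

section

/-- There are switching-time functions that are as fast as prescribed from given times on. -/
theorem exists_isSwitchingTime_le {T : ℝ} (hT : 0 < T) {c : ℕ → ℝ} (hc : ∀ i, 0 < c i) :
    ∃ τ : ℝ → ℝ, IsSwitchingTime T τ ∧
      ∀ i n : ℕ, i ≤ n → ∀ t, (n : ℝ) * T ≤ t → τ t ≤ c i := by
  -- A running minimum is automatically non-increasing; the entries `1 / (i + 1)` force it to `0`.
  set θ : ℕ → ℝ := fun n => (Finset.range (n + 1)).inf' Finset.nonempty_range_add_one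
    fun i => min (c i) (1 / ((i : ℝ) + 1)) with hθ
  have hle : ∀ i n, i ≤ n → θ n ≤ min (c i) (1 / ((i : ℝ) + 1)) := fun i n hin =>
    Finset.inf'_le (fun i : ℕ => min (c i) (1 / ((i : ℝ) + 1)))
      (Finset.mem_range.2 (Nat.lt_succ_of_le hin))
  have hpos : ∀ n, 0 < θ n := fun n =>
    (Finset.lt_inf'_iff _).2 fun i _ => lt_min (hc i) (by positivity)
  have hanti : Antitone θ := fun n n' h =>
    Finset.le_inf' _ _ fun i hi => hle i n' (by have := Finset.mem_range.1 hi; omega)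
  have hlim : Tendsto θ atTop (𝓝 0) :=
    squeeze_zero (fun n => (hpos n).le) (fun n => (hle n n le_rfl).trans (min_le_right _ _))
      tendsto_one_div_add_atTop_nhds_zero_nat
  refine ⟨fun t => θ ⌊t / T⌋₊, ⟨fun t _ => hpos _, fun s _ t _ h => ?_, fun n s hs => ?_, ?_⟩,
    fun i n hin t ht => ?_⟩
  · exact hanti (Nat.floor_mono (by gcongr))
  · have h1 : ⌊s / T⌋₊ = n := by
      rw [Nat.floor_eq_iff (div_nonneg ((by positivity : (0:ℝ) ≤ n * T).trans hs.1) hT.le),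
        le_div_iff₀ hT, div_lt_iff₀ hT]
      exact hs
    simp only [h1, mul_div_cancel_right₀ _ hT.ne', Nat.floor_natCast]
  · exact hlim.comp (tendsto_nat_floor_atTop.comp (tendsto_id.atTop_div_const hT))
  · refine (hle i _ (hin.trans ?_)).trans (min_le_left _ _)
    exact Nat.le_floor ((le_div_iff₀ hT).2 ht)

variable {d m : ℕ} [NeZero m]

/-- If solutions of the averaged system move from `P` close to `0` within time `N T` and stay in the
ball of radius `β`, then so do the solutions of the scheduled system, up to a small error, provided
that the switching is fast enough. -/
theorem exists_tracking_to_ball {H : Fin m → State d → State d} {K M T : ℝ} (hK : 0 < K)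
    (hL : ∀ k p q, ‖H k p - H k q‖ ≤ K * ‖p - q‖) (hb : ∀ k p, ‖H k p‖ ≤ M) (hT : 0 < T)
    {P : Set (State d)} {β ρ ε : ℝ} (hρ : 0 < ρ) (hε : 0 < ε) (N : ℕ)
    (hP : ∀ (a : ℝ), ∀ x₀ ∈ P, ∀ y, IsTrajectory (fun _ => meanField H) a x₀ y →
      (∀ t, a ≤ t → ‖y t‖ ≤ β) ∧ ‖y (a + N * T)‖ ≤ ρ / 2) :
    ∃ c : ℝ, 0 < c ∧ ∀ τ : ℝ → ℝ, IsSwitchingTime T τ → ∀ (x₀ : State d) (z : ℝ → State d),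
      IsTrajectory (fun s => H (activeInput m τ s)) 0 x₀ z →
      (∀ s t, ‖z s - z t‖ ≤ M * |s - t|) → ∀ n : ℕ, (∀ t, n * T ≤ t → τ t ≤ c) → z (n * T) ∈ P →
        (∀ t ∈ Icc (n * T) ((n + N) * T), ‖z t‖ ≤ β + ε) ∧ ‖z ((n + N) * T)‖ ≤ ρ := by
  obtain ⟨c, hc, htr⟩ := exists_tracking hK.le hL hb hT N (lt_min hε (half_pos hρ))
  refine ⟨c, hc, fun τ hτ x₀ z hz hzL n hn hzP => ?_⟩
  obtain ⟨y, hy⟩ := exists_isTrajectory_autonomous hK (meanField_norm_sub_le hL)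
    (meanField_norm_le hb) (n * T) (z (n * T))
  have h1 := htr τ hτ x₀ z hz hzL n hn y hy
  obtain ⟨h2, h3⟩ := hP _ _ hzP y hy
  constructor
  · intro t ht
    have := norm_le_norm_sub_add (z t) (y t)
    have := (h1 t ht).trans (min_le_left _ _)
    linarith [h2 t ht.1]
  · rw [← add_mul] at h3
    have := norm_le_norm_sub_add (z ((n + N) * T)) (y ((n + N) * T))
    have := (h1 ((n + N) * T) ⟨by gcongr; simp, le_rfl⟩).trans (min_le_right _ _)
    linarith

/-- A curve that runs through infinitely many phases, in the `j`-th of which it is bounded by `β j`,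
is bounded by `β j` from the beginning of the `j`-th phase on. -/
theorem norm_le_of_phases {T : ℝ} (hT : 0 < T) {β : ℕ → ℝ} (hβ : Antitone β) {N : ℕ → ℕ}
    (hN : ∀ j, 1 ≤ N j) {z : ℝ → State d}
    (hz : ∀ j, ∀ t ∈ Icc (((∑ i ∈ Finset.range j, N i : ℕ) : ℝ) * T)
      (((∑ i ∈ Finset.range (j + 1), N i : ℕ) : ℝ) * T), ‖z t‖ ≤ β j) (j : ℕ) :
    ∀ t, ((∑ i ∈ Finset.range j, N i : ℕ) : ℝ) * T ≤ t → ‖z t‖ ≤ β j := by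
  intro t ht
  have hle : ∀ k, k ≤ ∑ i ∈ Finset.range k, N i := fun k => by
    simpa using Finset.card_nsmul_le_sum (Finset.range k) N 1 fun i _ => hN i
  have key : ∀ k, t ≤ ((∑ i ∈ Finset.range (j + k), N i : ℕ) : ℝ) * T → ‖z t‖ ≤ β j := by
    intro k
    induction k with
    | zero =>
      intro h
      refine hz j t ⟨ht, h.trans ?_⟩
      rw [add_zero, Finset.sum_range_succ]
      push_cast
      gcongr
      simp
    | succ k ih =>
      intro h
      rcases le_total t (((∑ i ∈ Finset.range (j + k), N i : ℕ) : ℝ) * T) with h' | h'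
      · exact ih h'
      · exact (hz (j + k) t ⟨h', h⟩).trans (hβ (Nat.le_add_right _ _))
  obtain ⟨k, hk⟩ := exists_nat_ge (t / T)
  refine key k (((div_le_iff₀ hT).1 hk).trans ?_)
  have := hle (j + k)
  gcongr
  omega

end

end RoundRobin

/-! ### Assembly of the phases for a given initial state. -/

theorem theorem3 {d m : ℕ} [NeZero m]
    (f : State d → State d) (g : Fin m → State d → State d) (u : Fin m → State d → ℝ)
    (hf : ContDiff ℝ 1 f) (hg : ∀ k, ContDiff ℝ 1 (g k))
    (hlip : ∀ k, LocallyLipschitz (mode f g u k))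
    (hhyp : IsHyperbolicEquilibrium (closedLoop f g u))
    (hstable : IsLocallyAsymptoticallyStable (closedLoop f g u))
    (hC2 : ∃ U ∈ 𝓝 (0 : State d), ContDiffOn ℝ 2 (closedLoop f g u) U)
    (hf0 : f 0 = 0) (hu0 : ∀ k, u k 0 = 0)
    (T : ℝ) (hT : 0 < T) :
    ∀ x₀ ∈ basin (closedLoop f g u), ∃ τ' : ℝ → ℝ, IsSwitchingTime T τ' ∧
      ∀ τ : ℝ → ℝ, IsSwitchingTime T τ → Dominates τ τ' → ∀ t₀ : ℝ, 0 ≤ t₀ →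
        ∃ z : ℝ → State d, IsTrajectory (scheduled f g u τ t₀) t₀ x₀ z ∧
          (∀ z', IsTrajectory (scheduled f g u τ t₀) t₀ x₀ z' → EqOn z' z (Ici t₀)) ∧
          Tendsto z atTop (𝓝 0) := by
  rintro x₀ ⟨⟨x, hx⟩, hlim⟩
  have hx0 := hlim x hx
  -- The nominal solution is bounded.
  obtain ⟨R, hR0, hR⟩ : ∃ R : ℝ, 0 ≤ R ∧ ∀ t, 0 ≤ t → ‖x t‖ ≤ R := by
    obtain ⟨t₁, ht₁⟩ := eventually_atTop.1
      (hx0.norm.eventually (Iio_mem_nhds (show ‖(0 : State d)‖ < 1 by simp)))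
    obtain ⟨R₁, hR₁⟩ := (isCompact_Icc (a := (0 : ℝ)) (b := t₁)).exists_bound_of_continuousOn
      (hx.continuousOn.mono Icc_subset_Ici_self)
    refine ⟨max R₁ 1, le_max_of_le_right zero_le_one, fun t ht => ?_⟩
    rcases le_total t t₁ with h | h
    · exact (hR₁ t ⟨ht, h⟩).trans (le_max_left _ _)
    · exact (show ‖x t‖ < 1 from ht₁ t h).le.trans (le_max_right _ _)
  -- Outside the ball of radius `R + 1` the vector fields are truncated.
  have hr : 0 < R + 1 := by linarith
  -- The cube onto which `clamp` projects lies in the ball of radius `√d * (R + 1)`.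
  obtain ⟨K, M, hK, hM, hKM⟩ := exists_lipschitz_bound_on_ball hlip (√d * (R + 1))
  set H : Fin m → State d → State d := fun k p => mode f g u k (clamp (R + 1) p) with hH
  have hL : ∀ k p q, ‖H k p - H k q‖ ≤ K * ‖p - q‖ := fun k p q =>
    (hKM k _ _ (norm_clamp_le hr.le p) (norm_clamp_le hr.le q)).1.trans
      (mul_le_mul_of_nonneg_left (norm_clamp_sub_clamp_le _ p q) hK.le)
  have hb : ∀ k p, ‖H k p‖ ≤ M := fun k p =>
    (hKM k _ _ (norm_clamp_le hr.le p) (norm_clamp_le hr.le p)).2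
  have hHeq : ∀ k p, ‖p‖ ≤ R + 1 → H k p = mode f g u k p := fun k p hp => by
    simp only [hH, clamp_eq_self hp]
  have hFA : ∀ p, ‖p‖ ≤ R + 1 → closedLoop f g u p = meanField H p := fun p hp => by
    rw [← meanField_mode]
    simp only [meanField, hHeq _ p hp]
  have hAL := meanField_norm_sub_le hL
  have hAb := meanField_norm_le hb
  -- Radii of the phases.
  set e : ℕ → ℝ := fun j => 1 / ((j : ℝ) + 1) / 2 with he
  have he0 : ∀ j, 0 < e j := fun j => by positivity
  choose D hD0 hD using fun j =>
    exists_stable_of_eqOn_ball hstable hK.le hAL hr hFA (he0 j)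
  have hxA : IsTrajectory (fun _ => meanField H) 0 x₀ x :=
    hx.congr fun s hs => hFA _ ((hR s hs).trans (by linarith))
  set P : ℕ → Set (State d) := fun j => Nat.casesOn j {x₀} fun i => Metric.closedBall 0 (D i)
    with hP
  set β : ℕ → ℝ := fun j => Nat.casesOn j R e with hβ
  set η : ℕ → ℝ := fun j => Nat.casesOn j 1 e with hη
  have hη0 : ∀ j, 0 < η j := by
    rintro (_ | j)
    · exact one_pos
    · exact he0 j
  have hPc : ∀ j, IsCompact (P j) := by
    rintro (_ | j)
    · exact isCompact_singleton
    · exact isCompact_closedBall _ _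
  have hPy : ∀ j (a : ℝ), ∀ p ∈ P j, ∀ y, IsTrajectory (fun _ => meanField H) a p y →
      (∀ t, a ≤ t → ‖y t‖ ≤ β j) ∧ Tendsto y atTop (𝓝 0) := by
    rintro (_ | j) a p hp y hy
    · obtain rfl : p = x₀ := hp
      have hxa := hxA.shift (-a)
      rw [zero_sub, neg_neg] at hxa
      have heq := hy.eqOn_of_lipschitz hK.le hAL hxa
      refine ⟨fun t ht => ?_, ?_⟩
      · rw [heq ht]
        exact hR _ (by linarith)
      · have h1 : Tendsto (fun s => x (s + -a)) atTop (𝓝 0) :=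
          hx0.comp (tendsto_atTop_add_const_right _ _ tendsto_id)
        exact h1.congr' ((eventually_ge_atTop a).mono fun t ht => (heq ht).symm)
    · exact hD j a p (mem_closedBall_zero_iff.1 hp) y hy
  choose N hN1 hN using fun j => exists_uniform_attraction hstable hK hAL hAb hr hFA hT (hPc j)
    (fun p hp y hy => (hPy j 0 p hp y hy).2) (half_pos (hD0 j))
  -- The target radius `D j` of phase `j` is the radius of the starting set `P (j + 1)`, so the
  -- phases can be chained.
  choose c hc0 hc using fun j => exists_tracking_to_ball hK hL hb hT (P := P j) (β := β j)
    (hD0 j) (hη0 j) (N j) fun a p hp y hy => ⟨(hPy j a p hp y hy).1, hN j a p hp y hy⟩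
  obtain ⟨τ', hτ', hτ'c⟩ := exists_isSwitchingTime_le hT hc0
  refine ⟨τ', hτ', fun τ hτ hdom t₀ ht₀ => ?_⟩
  -- The solution of the truncated scheduled system.
  obtain ⟨z, hz, hzL⟩ : ∃ z, IsTrajectory (fun s => H (activeInput m τ s)) 0 x₀ z ∧
      ∀ s t, ‖z s - z t‖ ≤ M * |s - t| := by
    -- Monotonicity is known only on `[0, ∞)`; freezing `τ` at negative times gives a function
    -- antitone on `ℝ`, hence measurable.
    have hmeas : Measurable fun s => τ (max s 0) := by
      have : Antitone fun s => τ (max s 0) := fun s t h =>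
        hτ.antitone (mem_Ici.2 (le_max_right _ _)) (mem_Ici.2 (le_max_right _ _))
          (max_le_max h le_rfl)
      exact this.measurable
    have hHc : ∀ k, Continuous (H k) := fun k =>
      (LipschitzWith.of_dist_le_mul (K := ⟨K, hK.le⟩) fun p q => by
        rw [dist_eq_norm, dist_eq_norm]; exact hL k p q).continuous
    obtain ⟨z, hz, hzL⟩ := exists_isTrajectory
      (G := fun s => H (activeInput m (fun s => τ (max s 0)) s)) hK hM (fun _ => hL _)
      (fun _ => hb _) (fun w hw => measurable_family_comp hHc (measurable_activeInput hmeas) hw) x₀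
    refine ⟨z, hz.congr fun s hs => ?_, hzL⟩
    have : activeInput m (fun s => τ (max s 0)) s = activeInput m τ s := by
      simp only [activeInput, switchIndex, max_eq_left hs]
    rw [this]
  -- Phase `j` starts no earlier than `j * T`, when `τ'` is already below `c j`.
  have hsum : ∀ j, j ≤ ∑ i ∈ Finset.range j, N i := fun j => by
    simpa using Finset.card_nsmul_le_sum (Finset.range j) N 1 fun i _ => hN1 i
  have hτc : ∀ j t, ((∑ i ∈ Finset.range j, N i : ℕ) : ℝ) * T ≤ t → τ t ≤ c j := fun j t ht =>
    (hdom t (le_trans (by positivity) ht)).trans (hτ'c j _ (hsum j) t ht)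
  have hzP : ∀ j, z (((∑ i ∈ Finset.range j, N i : ℕ) : ℝ) * T) ∈ P j := by
    intro j
    induction j with
    | zero => simpa [hP] using hz.apply_initial
    | succ j ih =>
      have := (hc j τ hτ x₀ z hz hzL _ (hτc j) ih).2
      rw [Finset.sum_range_succ, Nat.cast_add]
      exact mem_closedBall_zero_iff.2 this
  have hanti : Antitone fun j => β j + η j := by
    have hea : Antitone e := fun i j h => by
      simp only [he]
      gcongr
    refine antitone_nat_of_succ_le ?_
    rintro (_ | j)
    · have : e 0 = 1 / 2 := by simp [he]
      change e 0 + e 0 ≤ R + 1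
      rw [this]
      linarith
    · change e (j + 1) + e (j + 1) ≤ e j + e j
      linarith [hea (Nat.le_succ j)]
  have hzb := norm_le_of_phases hT hanti hN1 fun j t ht =>
    (hc j τ hτ x₀ z hz hzL _ (hτc j) (hzP j)).1 t (by
      rwa [Finset.sum_range_succ, Nat.cast_add] at ht)
  have hz0 : Tendsto z atTop (𝓝 0) := by
    rw [NormedAddGroup.tendsto_nhds_zero]
    intro ε hε
    obtain ⟨j, hj⟩ := exists_nat_one_div_lt hε
    filter_upwards [eventually_ge_atTop (((∑ i ∈ Finset.range (j + 1), N i : ℕ) : ℝ) * T)]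
      with t ht
    refine (hzb (j + 1) t ht).trans_lt ?_
    change 1 / ((j : ℝ) + 1) / 2 + 1 / ((j : ℝ) + 1) / 2 < ε
    linarith
  -- Since `z` never leaves the ball of radius `R + 1`, the truncation is inactive along it.
  have hzm : IsTrajectory (fun s => mode f g u (activeInput m τ s)) 0 x₀ z :=
    hz.congr fun s hs => hHeq _ _ (hzb 0 s (by simpa using hs))
  -- The schedule is clocked from the start, so `t₀` enters only through a time shift and `τ'` does
  -- not depend on it.
  have hzt := hzm.shift (-t₀)
  rw [zero_sub, neg_neg] at hzt
  have hzs : IsTrajectory (scheduled f g u τ t₀) t₀ x₀ fun s => z (s + -t₀) := hzt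
  refine ⟨_, hzs, fun z' hz' => hz'.eqOn hzs fun Q => ?_,
    hz0.comp (tendsto_atTop_add_const_right _ _ tendsto_id)⟩
  obtain ⟨K', _, hK', _, hKM'⟩ := exists_lipschitz_bound_on_ball hlip Q
  exact ⟨K', hK'.le, fun s p q hp hq => (hKM' _ p q hp hq).1⟩
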